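/- Let $\kappa$ be a regular cardinal, let $\mathsf A$ be a $\kappa$-accessible category, and let $\mathsf A_{<\kappa}\subset\mathsf A$ be the full subcategory of $\kappa$-presentable objects. A class $\mathcal P$ of morphisms in a category $\mathsf C$ is called a *QE-epi class* if (i) for all $p\colon D\to E$ in $\mathcal P$ and $f\colon E'\to E$ in $\mathsf C$, the pullback $D'=D\times_E E'$ exists and the morphism $D'\to E'$ belongs to $\mathcal P$; (ii) every morphism in $\mathcal P$ is the coequalizer of its kernel pair; (iii) $\mathcal P$ contains all identity morphisms and is closed under composition. A *$\mathcal P$-sequence* is a diagram $K\rightrightarrows D\xrightarrow{p}E$ in which $p\in\mathcal P$ and $K\rightrightarrows D$ is the kernel pair of $p$. A QE-epi class $\mathcal P$ in $\mathsf A$ is called *strongly locally $\kappa$-coherent* if (a) the $\mathcal P$-sequences are precisely the $\kappa$-directed colimits of $\mathcal P$-sequences whose three terms $K,D,E$ all belong to $\mathsf A_{<\kappa}$, the colimits being taken in the category of diagrams $K\rightrightarrows D\to E$ in $\mathsf A$ with equal compositions $K\rightrightarrows E$; and (b) for every pullback square with $p\colon D\to E$ in $\mathcal P$, $f\colon E'\to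 E$, and $D,E,E'\in\mathsf A_{<\kappa}$, the pullback $D'=D\times_E E'$ also belongs to $\mathsf A_{<\kappa}$. Then there is a bijection between the strongly locally $\kappa$-coherent QE-epi classes $\mathcal P$ in $\mathsf A$ and the QE-epi classes $\mathcal Q$ in the category $\mathsf A_{<\kappa}$ that are closed under retracts in the category of morphisms $\mathsf A_{<\kappa}^{\to}$. The bijection sends $\mathcal P$ to $\mathcal Q=\mathcal P\cap\mathsf A_{<\kappa}^{\to}$, the class of all morphisms in $\mathcal P$ with $\kappa$-presentable domain and codomain. The inverse bijection sends $\mathcal Q$ to $\mathcal P=\varinjlim_{(\kappa)}\mathcal Q$, the class of all morphisms of $\mathsf A$ that are $\kappa$-directed colimits, in the category of morphisms $\mathsf A^{\to}$, of morphisms from $\mathcal Q$. -/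

import Mathlib

universe w v u

open CategoryTheory CategoryTheory.Limits

namespace QEEpi

section QEEpiClasses

variable {C : Type u} [Category.{v} C]

/-- A class of morphisms `P` in a category `C` is a QE-epi class if:
all pullbacks of morphisms from `P` exist and belong to `P`; every morphism from `P` is
the coequalizer of its kernel pair; and `P` contains the identities and is closed under
composition. -/
structure IsQEEpiClass (P : MorphismProperty C) : Prop where
  hasPullback {D E E' : C} (p : D ⟶ E) (f : E' ⟶ E) (hp : P p) : HasPullback p f
  isStableUnderBaseChange : P.IsStableUnderBaseChange
  isCoequalizer {K D E : C} (p : D ⟶ E) (hp : P p) (k₁ k₂ : K ⟶ D)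
    (h : IsKernelPair p k₁ k₂) : Nonempty (IsColimit (Cofork.ofπ p h.w))
  isMultiplicative : P.IsMultiplicative

/-- The objects of the finite category indexing diagrams `K ⇉ D ⟶ E`. -/
inductive Shape : Type
  | K : Shape
  | D : Shape
  | E : Shape

/-- The morphisms of the finite category indexing diagrams `K ⇉ D ⟶ E` in which both
compositions `K ⟶ E` agree: besides the identities there are exactly four of them. -/
inductive Shape.Hom : Shape → Shape → Type
  | id (X : Shape) : Shape.Hom X X
  | fst : Shape.Hom Shape.K Shape.D
  | snd : Shape.Hom Shape.K Shape.D
  | proj : Shape.Hom Shape.D Shape.E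
  | diag : Shape.Hom Shape.K Shape.E

/-- Composition of morphisms in the category `Shape`. -/
def Shape.Hom.comp : {X Y Z : Shape} → Shape.Hom X Y → Shape.Hom Y Z → Shape.Hom X Z
  | _, _, _, .id _, g => g
  | _, _, _, .fst, .id _ => .fst
  | _, _, _, .snd, .id _ => .snd
  | _, _, _, .proj, .id _ => .proj
  | _, _, _, .diag, .id _ => .diag
  | _, _, _, .fst, .proj => .diag
  | _, _, _, .snd, .proj => .diag

instance : SmallCategory Shape where
  Hom := Shape.Hom
  id := Shape.Hom.id
  comp := Shape.Hom.comp
  id_comp f := by cases f <;> rfl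
  comp_id f := by cases f <;> rfl
  assoc f g h := by cases f <;> cases g <;> cases h <;> rfl

/-- The first arrow `K ⟶ D`. -/
def Shape.fst : Shape.K ⟶ Shape.D := Shape.Hom.fst

/-- The second arrow `K ⟶ D`. -/
def Shape.snd : Shape.K ⟶ Shape.D := Shape.Hom.snd

/-- The arrow `D ⟶ E`. -/
def Shape.proj : Shape.D ⟶ Shape.E := Shape.Hom.proj

/-- The `P`-sequences: the diagrams `K ⇉ D ⟶ E` such that `D ⟶ E` belongs to `P` and `K ⇉ D` is
its kernel pair. -/
def sequences (P : MorphismProperty C) : ObjectProperty (Shape ⥤ C) := fun F ↦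
  P (F.map Shape.proj) ∧ IsKernelPair (F.map Shape.proj) (F.map Shape.fst) (F.map Shape.snd)

end QEEpiClasses

/-- The class of all colimits, in the category `C`, of objects from `T`, the diagrams being
indexed by small `κ`-directed posets.
(A poset is `κ`-filtered as a category if and only if every subset of cardinality less than `κ`
has an upper bound.) -/
def directedColimits {C : Type u} [Category.{v} C] (κ : Cardinal.{w}) [Fact κ.IsRegular]
    (T : ObjectProperty C) : ObjectProperty C := fun X ↦
  ∃ (J : Type w) (_ : PartialOrder J) (_ : IsCardinalFiltered J κ), T.colimitsOfShape J X

section Accessible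

variable {A : Type u} [Category.{w} A] (κ : Cardinal.{w}) [Fact κ.IsRegular]

/-- A QE-epi class `P` is locally `κ`-coherent if the `P`-sequences are precisely all
the `κ`-directed colimits, in the category of diagrams `K ⇉ D ⟶ E`, of `P`-sequences with
`κ`-presentable terms. -/
structure IsLocallyCoherent (P : MorphismProperty A) : Prop where
  isQEEpiClass : IsQEEpiClass P
  sequences_eq : sequences P = directedColimits κ
    (fun F : Shape ⥤ A ↦ sequences P F ∧ ∀ i, isCardinalPresentable A κ (F.obj i))

/-- A locally `κ`-coherent QE-epi class `P` is strongly locally `κ`-coherent if for any pullback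
square with `p : D ⟶ E` in `P`, with `f : E' ⟶ E`, and with `D`, `E`, `E'` all `κ`-presentable,
the pullback `D'` is `κ`-presentable. -/
structure IsStronglyLocallyCoherent (P : MorphismProperty A) : Prop
    extends IsLocallyCoherent κ P where
  isCardinalPresentable_pullback {D' D E' E : A} {f' : D' ⟶ D} {p' : D' ⟶ E'} {p : D ⟶ E}
    {f : E' ⟶ E} (sq : IsPullback f' p' p f) (hp : P p) (hD : isCardinalPresentable A κ D)
    (hE : isCardinalPresentable A κ E) (hE' : isCardinalPresentable A κ E') :
    isCardinalPresentable A κ D'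

/-- The class `P ∩ A_{<κ}^→` of morphisms from `P` between `κ`-presentable objects, as a class of
morphisms in the full subcategory `A_{<κ}` of `κ`-presentable objects. -/
def restrict (P : MorphismProperty A) :
    MorphismProperty (isCardinalPresentable A κ).FullSubcategory :=
  P.inverseImage (isCardinalPresentable A κ).ι

/-- The class of all the morphisms in `A` that are `κ`-directed colimits, in the category of
morphisms of `A`, of morphisms belonging to a class `Q` of morphisms in `A_{<κ}`. -/
def colimitClosure (Q : MorphismProperty (isCardinalPresentable A κ).FullSubcategory) :
    MorphismProperty A := fun _ _ f ↦
  directedColimits κ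
    (fun g : Arrow A ↦ ∃ (S T : (isCardinalPresentable A κ).FullSubcategory) (q : S ⟶ T),
      Q q ∧ g = Arrow.mk ((isCardinalPresentable A κ).ι.map q)) (Arrow.mk f)

end Accessible

end QEEpi

/-! In a `κ`-accessible category every object is a `κ`-directed colimit of `κ`-presentable ones, so
the presentable objects suffice to test a pullback, and a map out of a presentable object, or an
equality of such maps, is visible at some stage of a `κ`-directed colimit. Hence `κ`-filtered
colimits of pullback squares are pullback squares (`isPullback_of_colimitPresentation`).

From `Q` to `P`: given `p` in the closure and any `f` with the same target, both are presented over
one directed poset with a common presentation of the target (`exists_common_refinement`,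
`exists_compatible_presentation`). The pullback of `p` along `f` is then the colimit of stagewise
pullbacks of morphisms of `Q`. This gives existence and stability of pullbacks. It also gives
composition, by presenting the first factor over the stages of the second, and it presents kernel
pairs, whence the coequalizer property and the description of the `P`-sequences.

The maps are mutually inverse for two reasons. A colimit of morphisms of `Q` with presentable ends
is a retract of a stage (`mem_of_directedClosure`), so closure under retracts recovers `Q`.
Conversely, the two conditions on `P` make it the closure of its presentable part
(`directedClosure_presentablePart`). That this part is closed under retracts holds because a retract
is itself a `κ`-directed colimit (`directedColimits_of_retract`). -/

namespace QEEpi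

/-! ### Pullbacks in `κ`-filtered colimits, and common refinements of presentations. -/

section FilteredColimits

variable {A : Type u} [Category.{w} A] {κ : Cardinal.{w}} [Fact κ.IsRegular]

/-- Existence and uniqueness of lifts can be tested on generators. -/
lemma isPullback_of_isCardinalPresentable [IsCardinalAccessibleCategory A κ]
    {P X Y Z : A} {a : P ⟶ X} {b : P ⟶ Y} {f : X ⟶ Z} {g : Y ⟶ Z} (sq : a ≫ f = b ≫ g)
    (h : ∀ (S : A) [IsCardinalPresentable S κ] (u : S ⟶ X) (v : S ⟶ Y), u ≫ f = v ≫ g →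
      ∃! l : S ⟶ P, l ≫ a = u ∧ l ≫ b = v) :
    IsPullback a b f g := by
  -- An arbitrary test object is a colimit of presentable ones; uniqueness of the lifts on the
  -- stages makes them a cocone.
  have key (S : A) (u : S ⟶ X) (v : S ⟶ Y) (huv : u ≫ f = v ≫ g) :
      ∃! l : S ⟶ P, l ≫ a = u ∧ l ≫ b = v := by
    obtain ⟨J, _, _, ⟨p⟩⟩ :=
      (isCardinalFilteredGenerator_isCardinalPresentable A κ).exists_colimitsOfShape S
    have hp (j : J) : IsCardinalPresentable (p.diag.obj j) κ := p.prop_diag_obj j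
    choose l hl hl' using fun j ↦ h (p.diag.obj j) (p.ι.app j ≫ u) (p.ι.app j ≫ v)
      (by simp only [Category.assoc, huv])
    let c : Cocone p.diag := Cocone.mk P
      { app := l
        naturality := fun i j t ↦ by
          have ht := p.w t
          dsimp at ht ⊢
          rw [Category.comp_id]
          refine hl' i _ ⟨?_, ?_⟩
          · rw [Category.assoc, (hl j).1, reassoc_of% ht]
          · rw [Category.assoc, (hl j).2, reassoc_of% ht] }
    have hc (j : J) : p.ι.app j ≫ p.isColimit.desc c = l j := p.isColimit.fac c j
    have hc' (j : J) {T : A} (r : P ⟶ T) : p.ι.app j ≫ p.isColimit.desc c ≫ r = l j ≫ r := by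
      rw [← hc j, Category.assoc]
    refine ⟨p.isColimit.desc c, ⟨p.isColimit.hom_ext fun j ↦ ?_, p.isColimit.hom_ext fun j ↦ ?_⟩,
      fun m hm ↦ p.isColimit.hom_ext fun j ↦ ?_⟩
    · exact (hc' j _).trans (hl j).1
    · exact (hc' j _).trans (hl j).2
    · refine Eq.trans (hl' j _ ⟨?_, ?_⟩) (hc j).symm
      · exact (Category.assoc _ _ _).trans (congrArg (p.ι.app j ≫ ·) hm.1)
      · exact (Category.assoc _ _ _).trans (congrArg (p.ι.app j ≫ ·) hm.2)
  choose l hl hl' using fun (s : PullbackCone f g) ↦ key s.pt s.fst s.snd s.condition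
  exact ⟨⟨sq⟩, ⟨PullbackCone.IsLimit.mk sq l (fun s ↦ (hl s).1) (fun s ↦ (hl s).2)
    (fun s m h₁ h₂ ↦ hl' s m ⟨h₁, h₂⟩)⟩⟩

/-- In a `κ`-accessible category, `κ`-filtered colimits of pullback squares are pullback
squares. -/
lemma isPullback_of_colimitPresentation [IsCardinalAccessibleCategory A κ]
    {J : Type w} [SmallCategory J] [IsCardinalFiltered J κ] {P X Y Z : A}
    (pP : ColimitPresentation J P) (pX : ColimitPresentation J X)
    (pY : ColimitPresentation J Y) (pZ : ColimitPresentation J Z)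
    (α : pP.diag ⟶ pX.diag) (β : pP.diag ⟶ pY.diag) (φ : pX.diag ⟶ pZ.diag)
    (ψ : pY.diag ⟶ pZ.diag)
    (sq : ∀ j, IsPullback (α.app j) (β.app j) (φ.app j) (ψ.app j))
    {a : P ⟶ X} {b : P ⟶ Y} {f : X ⟶ Z} {g : Y ⟶ Z}
    (ha : ∀ j, α.app j ≫ pX.ι.app j = pP.ι.app j ≫ a)
    (hb : ∀ j, β.app j ≫ pY.ι.app j = pP.ι.app j ≫ b)
    (hf : ∀ j, φ.app j ≫ pZ.ι.app j = pX.ι.app j ≫ f)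
    (hg : ∀ j, ψ.app j ≫ pZ.ι.app j = pY.ι.app j ≫ g) :
    IsPullback a b f g := by
  have := isFiltered_of_isCardinalFiltered J κ
  have comm : a ≫ f = b ≫ g := pP.isColimit.hom_ext fun j ↦ by
    dsimp at ha hb hf hg ⊢
    rw [← reassoc_of% ha j, ← hf, ← reassoc_of% hb j, ← hg, reassoc_of% (sq j).w]
  refine isPullback_of_isCardinalPresentable (κ := κ) comm (fun S _ u v huv ↦ ?_)
  refine existsUnique_of_exists_of_unique ?_ ?_
  · obtain ⟨j₁, u₁, hu⟩ := IsCardinalPresentable.exists_hom_of_isColimit κ pX.isColimit u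
    obtain ⟨j₂, v₂, hv⟩ := IsCardinalPresentable.exists_hom_of_isColimit κ pY.isColimit v
    dsimp at ha hb hf hg hu hv
    obtain ⟨j, s, t, hst⟩ := IsCardinalPresentable.exists_eq_of_isColimit κ pZ.isColimit
      (u₁ ≫ φ.app j₁) (v₂ ≫ ψ.app j₂) (by
        dsimp
        rw [Category.assoc, Category.assoc, hf, hg, reassoc_of% hu, reassoc_of% hv, huv])
    refine ⟨(sq j).lift (u₁ ≫ pX.diag.map s) (v₂ ≫ pY.diag.map t)
      (by simpa using hst) ≫ pP.ι.app j, ?_, ?_⟩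
    · have := pX.w s
      dsimp at this
      rw [Category.assoc, ← ha, IsPullback.lift_fst_assoc, Category.assoc, this, hu]
    · have := pY.w t
      dsimp at this
      rw [Category.assoc, ← hb, IsPullback.lift_snd_assoc, Category.assoc, this, hv]
  · rintro l m ⟨hl₁, hl₂⟩ ⟨hm₁, hm₂⟩
    obtain ⟨j₁, l', hl'⟩ := IsCardinalPresentable.exists_hom_of_isColimit κ pP.isColimit l
    obtain ⟨j₂, m', hm'⟩ := IsCardinalPresentable.exists_hom_of_isColimit κ pP.isColimit m
    dsimp at ha hb hf hg hl' hm'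
    obtain ⟨j, s, t, hst⟩ := IsCardinalPresentable.exists_eq_of_isColimit κ pX.isColimit
      (l' ≫ α.app j₁) (m' ≫ α.app j₂) (by
        dsimp
        rw [Category.assoc, Category.assoc, ha, ha, reassoc_of% hl', reassoc_of% hm', hl₁, hm₁])
    have hPs := pP.w s
    have hPt := pP.w t
    dsimp at hPs hPt
    -- The components in `X` agree from stage `j` on; moving on to `k` makes those in `Y` agree too,
    -- and the pullback at stage `k` identifies the two lifts there.
    obtain ⟨k, r, hr⟩ := IsCardinalPresentable.exists_eq_of_isColimit' κ pY.isColimit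
      (l' ≫ pP.diag.map s ≫ β.app j) (m' ≫ pP.diag.map t ≫ β.app j) (by
        dsimp
        simp only [Category.assoc, hb, reassoc_of% hPs, reassoc_of% hPt, reassoc_of% hl',
          reassoc_of% hm', hl₂, hm₂])
    have hPr := pP.w r
    dsimp at hPr
    rw [← hl', ← hm', ← hPs, ← hPt, ← hPr]
    simp only [← Category.assoc]
    congr 1
    refine (sq k).hom_ext ?_ ?_
    · simp only [Category.assoc, NatTrans.naturality] at hst ⊢
      simp only [NatTrans.naturality_assoc, reassoc_of% hst]
    · simp only [Category.assoc, NatTrans.naturality, NatTrans.naturality_assoc] at hr ⊢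
      exact hr

/-- Pointwise pullbacks of functors assemble to a functor. -/
lemma exists_functor_isPullback {J : Type*} [Category* J] {X Y Z : J ⥤ A} (φ : X ⟶ Z) (ψ : Y ⟶ Z)
    (h : ∀ j, HasPullback (φ.app j) (ψ.app j)) :
    ∃ (P : J ⥤ A) (α : P ⟶ X) (β : P ⟶ Y),
      ∀ j, IsPullback (α.app j) (β.app j) (φ.app j) (ψ.app j) := by
  have sq (j : J) := IsPullback.of_hasPullback (φ.app j) (ψ.app j)
  let P : J ⥤ A :=
    { obj := fun j ↦ pullback (φ.app j) (ψ.app j)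
      map := fun {i j} t ↦ (sq j).lift (pullback.fst _ _ ≫ X.map t) (pullback.snd _ _ ≫ Y.map t)
        (by simp [pullback.condition_assoc])
      map_id := fun j ↦ (sq j).hom_ext (by simp) (by simp)
      map_comp := fun {_ _ j} s t ↦ (sq j).hom_ext (by simp) (by simp) }
  exact ⟨P, { app := fun j ↦ pullback.fst _ _, naturality := fun _ j t ↦ (sq j).lift_fst _ _ _ },
    { app := fun j ↦ pullback.snd _ _, naturality := fun _ j t ↦ (sq j).lift_snd _ _ _ }, sq⟩

/-- The preorder of factorizations `F.obj k ⟶ G.obj j` of a morphism `f : X ⟶ Y` through the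
stages of colimit presentations of `X` and `Y`. -/
structure Factorization {J K : Type w} [PartialOrder J] [PartialOrder K] {X Y : A}
    (pX : ColimitPresentation K X) (pY : ColimitPresentation J Y) (f : X ⟶ Y) where
  src : K
  tgt : J
  hom : pX.diag.obj src ⟶ pY.diag.obj tgt
  w : hom ≫ pY.ι.app tgt = pX.ι.app src ≫ f

namespace Factorization

variable {J K : Type w} [PartialOrder J] [PartialOrder K]
    {X Y : A} {pX : ColimitPresentation K X} {pY : ColimitPresentation J Y} {f : X ⟶ Y}

instance : Preorder (Factorization pX pY f) where
  le s t := ∃ (h₁ : s.src ≤ t.src) (h₂ : s.tgt ≤ t.tgt),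
    s.hom ≫ pY.diag.map (homOfLE h₂) = pX.diag.map (homOfLE h₁) ≫ t.hom
  le_refl s := ⟨le_rfl, le_rfl, by simp⟩
  le_trans := by
    rintro s t r ⟨h₁, h₂, h⟩ ⟨h₁', h₂', h'⟩
    refine ⟨h₁.trans h₁', h₂.trans h₂', ?_⟩
    rw [← homOfLE_comp h₁ h₁', ← homOfLE_comp h₂ h₂', Functor.map_comp, Functor.map_comp,
      reassoc_of% h, h', Category.assoc]

/-- The stage of the source, as a functor. -/
def srcFunctor : Factorization pX pY f ⥤ K := Monotone.functor (f := src) fun _ _ h ↦ h.1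

/-- The stage of the target, as a functor. -/
def tgtFunctor : Factorization pX pY f ⥤ J := Monotone.functor (f := tgt) fun _ _ h ↦ h.2.1

/-- The tautological natural transformation between stages. -/
def natTrans : (srcFunctor (pX := pX) (pY := pY) (f := f)) ⋙ pX.diag ⟶ tgtFunctor ⋙ pY.diag where
  app s := s.hom
  naturality _ _ h := (leOfHom h).2.2.symm

variable [IsCardinalFiltered J κ] (hX : ∀ k, IsCardinalPresentable (pX.diag.obj k) κ)

include hX in
lemma exists_le_src_le_tgt (k : K) (j : J) :
    ∃ s : Factorization pX pY f, s.src = k ∧ j ≤ s.tgt := by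
  have := isFiltered_of_isCardinalFiltered J κ
  obtain ⟨j', g, hg⟩ := IsCardinalPresentable.exists_hom_of_isColimit κ pY.isColimit
    (pX.ι.app k ≫ f)
  refine ⟨⟨k, IsFiltered.max j j', g ≫ pY.diag.map (IsFiltered.rightToMax j j'), ?_⟩, rfl,
    leOfHom (IsFiltered.leftToMax j j')⟩
  have := pY.w (IsFiltered.rightToMax j j')
  dsimp at this hg ⊢
  rw [Category.assoc, this, hg]

lemma exists_upper_bound {J : Type w} [PartialOrder J] [IsCardinalFiltered J κ] {ι : Type w}
    (s : ι → J) (hι : Cardinal.mk ι < κ) : ∃ j, ∀ i, s i ≤ j :=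
  have hι' : HasCardinalLT ι κ := by rwa [hasCardinalLT_iff_cardinal_mk_lt]
  ⟨IsCardinalFiltered.max s hι', fun i ↦ leOfHom (IsCardinalFiltered.toMax s hι' i)⟩

variable [IsCardinalFiltered K κ]

-- To bound fewer than `κ` factorizations, factor through a source stage above all sources. Each
-- given factorization agrees with the new one in the colimit, hence at a later stage because its
-- source is presentable, and these fewer than `κ` later stages have a common bound.
include hX in
lemma isCardinalFiltered : IsCardinalFiltered (Factorization pX pY f) κ := by
  refine isCardinalFiltered_preorder _ _ fun ι s hι ↦ ?_
  obtain ⟨k, hk⟩ := exists_upper_bound (fun i ↦ (s i).src) hι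
  obtain ⟨j₀, hj₀⟩ := exists_upper_bound (fun i ↦ (s i).tgt) hι
  obtain ⟨⟨k', j, g, hg⟩, rfl, hj⟩ := exists_le_src_le_tgt (pY := pY) (f := f) hX k j₀
  dsimp at hj hk
  have H (i : ι) : ∃ (j' : J) (hj' : j ≤ j'),
      (s i).hom ≫ pY.diag.map (homOfLE (((hj₀ i).trans hj).trans hj')) =
        pX.diag.map (homOfLE (hk i)) ≫ g ≫ pY.diag.map (homOfLE hj') := by
    obtain ⟨j', t, ht⟩ := IsCardinalPresentable.exists_eq_of_isColimit' κ pY.isColimit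
      ((s i).hom ≫ pY.diag.map (homOfLE ((hj₀ i).trans hj)))
      (pX.diag.map (homOfLE (hk i)) ≫ g) (by
        have h₁ := pY.w (homOfLE ((hj₀ i).trans hj))
        have h₂ := pX.w (homOfLE (hk i))
        have h₃ := (s i).w
        dsimp at h₁ h₂ h₃ hg ⊢
        rw [Category.assoc, Category.assoc, h₁, hg, h₃, reassoc_of% h₂])
    refine ⟨j', leOfHom t, ?_⟩
    rw [Category.assoc, Category.assoc, ← Functor.map_comp] at ht
    exact ht
  choose j' hj' h using H
  obtain ⟨j₁, hj₁⟩ := exists_upper_bound j' hι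
  -- The bound `j₁` need not lie above `j` when the family is empty.
  obtain ⟨j₂, hj₂, hj₂'⟩ : ∃ j₂, j₁ ≤ j₂ ∧ j ≤ j₂ := by
    have := isFiltered_of_isCardinalFiltered J κ
    exact ⟨IsFiltered.max j₁ j, leOfHom (IsFiltered.leftToMax _ _),
      leOfHom (IsFiltered.rightToMax _ _)⟩
  refine ⟨⟨k', j₂, g ≫ pY.diag.map (homOfLE hj₂'), ?_⟩, fun i ↦ ⟨hk i,
    ((hj₀ i).trans hj).trans hj₂', ?_⟩⟩
  · have := pY.w (homOfLE hj₂')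
    dsimp at this hg ⊢
    rw [Category.assoc, this, hg]
  · have := h i =≫ pY.diag.map (homOfLE ((hj₁ i).trans hj₂))
    simp only [Category.assoc, ← Functor.map_comp, homOfLE_comp] at this
    exact this

include hX in
lemma final_srcFunctor : (srcFunctor (pX := pX) (pY := pY) (f := f)).Final := by
  have := isCardinalFiltered (pY := pY) (f := f) hX
  have := isFiltered_of_isCardinalFiltered (Factorization pX pY f) κ
  obtain ⟨j⟩ := IsCardinalFiltered.nonempty J κ
  rw [Functor.final_iff_of_isFiltered]
  refine ⟨fun k ↦ ?_, fun {k s} _ _ ↦ ⟨s, 𝟙 s, Subsingleton.elim _ _⟩⟩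
  obtain ⟨s, rfl, -⟩ := exists_le_src_le_tgt (pY := pY) (f := f) hX k j
  exact ⟨s, ⟨𝟙 _⟩⟩

include hX in
lemma final_tgtFunctor : (tgtFunctor (pX := pX) (pY := pY) (f := f)).Final := by
  have := isCardinalFiltered (pY := pY) (f := f) hX
  have := isFiltered_of_isCardinalFiltered (Factorization pX pY f) κ
  obtain ⟨k⟩ := IsCardinalFiltered.nonempty K κ
  rw [Functor.final_iff_of_isFiltered]
  refine ⟨fun j ↦ ?_, fun {k s} _ _ ↦ ⟨s, 𝟙 s, Subsingleton.elim _ _⟩⟩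
  obtain ⟨s, -, h⟩ := exists_le_src_le_tgt (pY := pY) (f := f) hX k j
  exact ⟨s, ⟨homOfLE h⟩⟩

end Factorization

/-- A morphism between two `κ`-directed colimits, the source being a colimit of `κ`-presentable
objects, is a colimit of morphisms between the stages. -/
lemma exists_common_refinement {J K : Type w} [PartialOrder J] [PartialOrder K]
    [IsCardinalFiltered J κ] [IsCardinalFiltered K κ]
    {X Y : A} (pX : ColimitPresentation K X) (pY : ColimitPresentation J Y) (f : X ⟶ Y)
    (hX : ∀ k, IsCardinalPresentable (pX.diag.obj k) κ) :
    ∃ (T : Type w) (_ : PartialOrder T) (_ : IsCardinalFiltered T κ) (a : T ⥤ K) (b : T ⥤ J)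
      (_ : a.Final) (_ : b.Final) (γ : a ⋙ pX.diag ⟶ b ⋙ pY.diag),
      ∀ t, γ.app t ≫ pY.ι.app (b.obj t) = pX.ι.app (a.obj t) ≫ f := by
  have := Factorization.isCardinalFiltered (pY := pY) (f := f) hX
  obtain ⟨T, _, _, F, _⟩ :=
    IsCardinalFiltered.exists_cardinal_directed (Factorization pX pY f) κ
  have := Factorization.final_srcFunctor (pY := pY) (f := f) hX
  have := Factorization.final_tgtFunctor (pY := pY) (f := f) hX
  exact ⟨T, inferInstance, inferInstance, F ⋙ Factorization.srcFunctor,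
    F ⋙ Factorization.tgtFunctor, inferInstance, inferInstance,
    F.whiskerLeft Factorization.natTrans, fun t ↦ (F.obj t).w⟩

end FilteredColimits

/-! ### Retracts as directed colimits. -/

section DirectedColimits

variable {C : Type u} [Category.{v} C] {κ : Cardinal.{w}} [Fact κ.IsRegular]

lemma directedColimits_of_iso {T : ObjectProperty C} {X Y : C} (e : X ≅ Y)
    (h : directedColimits κ T X) : directedColimits κ T Y := by
  obtain ⟨J, _, _, ⟨p⟩⟩ := h
  exact ⟨J, inferInstance, inferInstance, ⟨p.ofIso e⟩⟩

lemma le_directedColimits (T : ObjectProperty C) : T ≤ directedColimits κ T := fun X hX ↦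
  ⟨PUnit, inferInstance, isCardinalFiltered_of_hasTerminal _ _,
    ⟨{ toColimitPresentation := .self X, prop_diag_obj := fun _ ↦ hX }⟩⟩

open Classical in
/-- The chain of length `κ` all of whose proper transition maps are a given idempotent. -/
noncomputable def idempotentChain (J : Type w) [PartialOrder J] {Y : C} (e : Y ⟶ Y)
    (he : e ≫ e = e) : J ⥤ C where
  obj _ := Y
  map {i j} _ := if i = j then 𝟙 Y else e
  map_id _ := if_pos rfl
  map_comp {i j k} s t := by
    by_cases hij : i = j
    · subst hij; simp
    · by_cases hjk : j = k
      · subst hjk; simp [hij]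
      · have hik : i ≠ k := fun h ↦ hij ((leOfHom s).antisymm (h ▸ leOfHom t))
        simp [hij, hjk, hik, he]

lemma idempotentChain_map {J : Type w} [PartialOrder J] {Y : C} {e : Y ⟶ Y}
    (he : e ≫ e = e) {i j : J} (h : i < j) :
    (idempotentChain J e he).map (homOfLE h.le) = e := if_neg h.ne

/-- A retract of an object is a `κ`-directed colimit of copies of that object. -/
lemma directedColimits_of_retract {T : ObjectProperty C} {X Y : C} (h : Retract X Y) (hY : T Y) :
    directedColimits κ T X := by
  -- As `κ` is infinite, every index has a strictly later one, and the transition to it is the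
  -- idempotent rather than the identity.
  have : NoMaxOrder κ.ord.ToType :=
    Cardinal.noMaxOrder (Cardinal.IsRegular.aleph0_le Fact.out)
  obtain ⟨j₀⟩ := IsCardinalFiltered.nonempty κ.ord.ToType κ
  have he : (h.r ≫ h.i) ≫ h.r ≫ h.i = h.r ≫ h.i := by simp
  -- Any two legs equal the idempotent followed by a leg at a later index, so all legs coincide and
  -- absorb the idempotent.
  have hs (s : Cocone (idempotentChain κ.ord.ToType (h.r ≫ h.i) he)) (j : κ.ord.ToType) :
      (h.r ≫ h.i) ≫ s.ι.app j₀ = s.ι.app j := by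
    obtain ⟨k, hk⟩ := exists_gt (max j₀ j)
    have h₀ := s.w (homOfLE ((le_max_left _ _).trans_lt hk).le)
    have h₁ := s.w (homOfLE ((le_max_right _ _).trans_lt hk).le)
    rw [idempotentChain_map he ((le_max_left _ _).trans_lt hk)] at h₀
    rw [idempotentChain_map he ((le_max_right _ _).trans_lt hk)] at h₁
    rw [← h₀, ← h₁]
    exact (Category.assoc _ _ _).symm.trans (congrArg (· ≫ _) he)
  refine ⟨κ.ord.ToType, inferInstance, inferInstance,
    ⟨{ diag := idempotentChain _ (h.r ≫ h.i) he
       ι := { app := fun _ ↦ h.r, naturality := fun i j t ↦ ?_ }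
       isColimit := ?_
       prop_diag_obj := fun _ ↦ hY }⟩⟩
  · rcases (leOfHom t).eq_or_lt with rfl | hij
    · obtain rfl := Subsingleton.elim t (𝟙 _)
      rw [CategoryTheory.Functor.map_id, CategoryTheory.Functor.map_id]
      exact (Category.id_comp _).trans (Category.comp_id _).symm
    · obtain rfl := Subsingleton.elim t (homOfLE hij.le)
      rw [idempotentChain_map he hij]
      exact (Category.assoc _ _ _).trans (congrArg (h.r ≫ ·) h.retract)
  · exact
      { desc := fun s ↦ h.i ≫ s.ι.app j₀
        fac := fun s j ↦ (Category.assoc _ _ _).symm.trans (hs s j)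
        uniq := fun s m hm ↦ by
          rw [← hm j₀]
          exact ((Category.id_comp m).symm.trans (congrArg (· ≫ m) h.retract.symm)).trans
            (Category.assoc _ _ _) }

end DirectedColimits

/-! ### Colimit presentations of arrows and of diagrams `K ⇉ D ⟶ E`, computed termwise. -/

section Arrows

variable {A : Type u} [Category.{v} A] {κ : Cardinal.{w}} [Fact κ.IsRegular]

lemma directedColimits_arrow_mk {W : MorphismProperty A} {J : Type w} [PartialOrder J]
    [IsCardinalFiltered J κ] {X Y : A} (pX : ColimitPresentation J X)
    (pY : ColimitPresentation J Y) (φ : pX.diag ⟶ pY.diag) (hφ : ∀ j, W (φ.app j)) {f : X ⟶ Y}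
    (hf : ∀ j, φ.app j ≫ pY.ι.app j = pX.ι.app j ≫ f) :
    directedColimits κ (fun g : Arrow A ↦ W g.hom) (Arrow.mk f) :=
  ⟨J, inferInstance, inferInstance,
    ⟨{ diag :=
        { obj := fun j ↦ Arrow.mk (φ.app j)
          map := fun t ↦ Arrow.homMk (pX.diag.map t) (pY.diag.map t) (by simp) }
       ι :=
        { app := fun j ↦ Arrow.homMk (pX.ι.app j) (pY.ι.app j) (by simpa using (hf j).symm)
          naturality := fun i j t ↦ by ext <;> simp }
       isColimit := Comma.fstSndJointlyReflectColimit pX.isColimit pY.isColimit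
       prop_diag_obj := hφ }⟩⟩

lemma exists_colimitPresentation_of_directedColimits [HasCardinalFilteredColimits.{w} A κ]
    {W : MorphismProperty A} {X Y : A} {f : X ⟶ Y}
    (h : directedColimits κ (fun g : Arrow A ↦ W g.hom) (Arrow.mk f)) :
    ∃ (J : Type w) (_ : PartialOrder J) (_ : IsCardinalFiltered J κ)
      (pX : ColimitPresentation J X) (pY : ColimitPresentation J Y) (φ : pX.diag ⟶ pY.diag),
      (∀ j, W (φ.app j)) ∧ ∀ j, φ.app j ≫ pY.ι.app j = pX.ι.app j ≫ f := by
  obtain ⟨J, _, _, ⟨p⟩⟩ := h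
  have := HasCardinalFilteredColimits.hasColimitsOfShape (κ := κ) A J
  refine ⟨J, inferInstance, inferInstance, p.toColimitPresentation.map Arrow.leftFunc,
    p.toColimitPresentation.map Arrow.rightFunc, Functor.whiskerLeft p.diag Arrow.leftToRight,
    p.prop_diag_obj, fun j ↦ ?_⟩
  refine Eq.trans ?_ ((Arrow.w (p.ι.app j)).symm.trans ?_)
  · simp only [ColimitPresentation.map_ι, Functor.constComp, NatTrans.comp_app,
      Functor.whiskerRight_app, Category.comp_id]
    rfl
  · simp only [ColimitPresentation.map_ι, Functor.constComp, NatTrans.comp_app,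
      Functor.whiskerRight_app, Category.comp_id]
    rfl

end Arrows

section Shape

variable {C : Type u} [Category.{v} C]

/-- The functor defined by a diagram `K ⇉ D ⟶ E`. -/
def Shape.functor {K D E : C} (k₁ k₂ : K ⟶ D) (p : D ⟶ E) (w : k₁ ≫ p = k₂ ≫ p) :
    Shape ⥤ C where
  obj
    | .K => K
    | .D => D
    | .E => E
  map
    | .id _ => 𝟙 _
    | .fst => k₁
    | .snd => k₂
    | .proj => p
    | .diag => k₁ ≫ p
  map_id _ := rfl
  map_comp := fun {X Y Z} (f : Shape.Hom X Y) (g : Shape.Hom Y Z) ↦ by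
    cases f <;> cases g <;>
      first
      | exact (Category.id_comp _).symm
      | exact (Category.comp_id _).symm
      | rfl
      | exact w

lemma Shape.w (F : Shape ⥤ C) :
    F.map Shape.fst ≫ F.map Shape.proj = F.map Shape.snd ≫ F.map Shape.proj := by
  rw [← F.map_comp, ← F.map_comp]
  rfl

/-- Constructor for natural transformations between diagrams `K ⇉ D ⟶ E`. -/
def Shape.natTransMk {F G : Shape ⥤ C} (a : F.obj .K ⟶ G.obj .K) (b : F.obj .D ⟶ G.obj .D)
    (c : F.obj .E ⟶ G.obj .E) (h₁ : F.map Shape.fst ≫ b = a ≫ G.map Shape.fst)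
    (h₂ : F.map Shape.snd ≫ b = a ≫ G.map Shape.snd)
    (h₃ : F.map Shape.proj ≫ c = b ≫ G.map Shape.proj) : F ⟶ G where
  app
    | .K => a
    | .D => b
    | .E => c
  naturality := fun X Y (f : Shape.Hom X Y) ↦ by
    cases f
    · exact (congrArg (· ≫ _) (F.map_id X)).trans ((Category.id_comp _).trans
        ((Category.comp_id _).symm.trans (congrArg (_ ≫ ·) (G.map_id X)).symm))
    · exact h₁
    · exact h₂
    · exact h₃
    · have hF : F.map Shape.Hom.diag = F.map Shape.fst ≫ F.map Shape.proj :=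
        F.map_comp Shape.fst Shape.proj
      have hG : G.map Shape.Hom.diag = G.map Shape.fst ≫ G.map Shape.proj :=
        G.map_comp Shape.fst Shape.proj
      rw [hF, hG]
      dsimp
      rw [Category.assoc, h₃, reassoc_of% h₁]

/-- A colimit presentation of a diagram `K ⇉ D ⟶ E` from presentations of its terms. -/
noncomputable def Shape.colimitPresentation {J : Type w} [Category* J] {F : Shape ⥤ C}
    (pK : ColimitPresentation J (F.obj .K)) (pD : ColimitPresentation J (F.obj .D))
    (pE : ColimitPresentation J (F.obj .E)) (α β : pK.diag ⟶ pD.diag) (φ : pD.diag ⟶ pE.diag)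
    (w : α ≫ φ = β ≫ φ)
    (hα : ∀ j, α.app j ≫ pD.ι.app j = pK.ι.app j ≫ F.map Shape.fst)
    (hβ : ∀ j, β.app j ≫ pD.ι.app j = pK.ι.app j ≫ F.map Shape.snd)
    (hφ : ∀ j, φ.app j ≫ pE.ι.app j = pD.ι.app j ≫ F.map Shape.proj) :
    ColimitPresentation J F where
  diag := (Shape.functor α β φ w).flip
  ι :=
    { app := fun j ↦ Shape.natTransMk (pK.ι.app j) (pD.ι.app j) (pE.ι.app j) (hα j) (hβ j) (hφ j)
      naturality := fun i j t ↦ by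
        ext X
        cases X
        · exact pK.ι.naturality t
        · exact pD.ι.naturality t
        · exact pE.ι.naturality t }
  isColimit := evaluationJointlyReflectsColimits _ fun X ↦ match X with
    | .K => pK.isColimit
    | .D => pD.isColimit
    | .E => pE.isColimit

end Shape

/-! ### The closure of a class of morphisms under `κ`-directed colimits. -/

section Closure

variable {A : Type u} [Category.{w} A] (κ : Cardinal.{w}) [Fact κ.IsRegular]

/-- The class of all `κ`-directed colimits of morphisms from a given class. -/
def directedClosure (W : MorphismProperty A) : MorphismProperty A := fun _ _ f ↦
  directedColimits κ (fun g : Arrow A ↦ W g.hom) (Arrow.mk f)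

/-- The QE-epi classes in the full subcategory of `κ`-presentable objects that are closed under
retracts, described as classes of morphisms in the ambient category. -/
structure IsPresentableQEEpiClass (W : MorphismProperty A) : Prop where
  isCardinalPresentable_src {X Y : A} {f : X ⟶ Y} (hf : W f) : IsCardinalPresentable X κ
  isCardinalPresentable_tgt {X Y : A} {f : X ⟶ Y} (hf : W f) : IsCardinalPresentable Y κ
  exists_isPullback {D E E' : A} {p : D ⟶ E} (f : E' ⟶ E) (hp : W p)
    (hE' : IsCardinalPresentable E' κ) :
    ∃ (D' : A) (f' : D' ⟶ D) (p' : D' ⟶ E'), IsPullback f' p' p f ∧ W p'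
  isCoequalizer {K D E : A} (p : D ⟶ E) (hp : W p) (k₁ k₂ : K ⟶ D)
    (h : IsKernelPair p k₁ k₂) : Nonempty (IsColimit (Cofork.ofπ p h.w))
  id_mem (X : A) (hX : IsCardinalPresentable X κ) : W (𝟙 X)
  comp_mem {X Y Z : A} (f : X ⟶ Y) (g : Y ⟶ Z) (hf : W f) (hg : W g) : W (f ≫ g)
  isStableUnderRetracts : W.IsStableUnderRetracts

variable {κ}

/-- Accessibility supplies a `κ`-filtered indexing category; a final functor from a `κ`-directed
poset replaces it by a poset. -/
lemma exists_colimitPresentation_isCardinalPresentable [IsCardinalAccessibleCategory A κ]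
    (X : A) :
    ∃ (J : Type w) (_ : PartialOrder J) (_ : IsCardinalFiltered J κ)
      (pX : ColimitPresentation J X), ∀ j, IsCardinalPresentable (pX.diag.obj j) κ := by
  obtain ⟨J, _, _, ⟨p⟩⟩ :=
    (isCardinalFilteredGenerator_isCardinalPresentable A κ).exists_colimitsOfShape X
  obtain ⟨T, _, _, F, _⟩ := IsCardinalFiltered.exists_cardinal_directed J κ
  exact ⟨T, inferInstance, inferInstance, p.toColimitPresentation.reindex F,
    fun t ↦ p.prop_diag_obj (F.obj t)⟩

lemma le_directedClosure (W : MorphismProperty A) : W ≤ directedClosure κ W :=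
  fun _ _ f hf ↦ le_directedColimits _ (Arrow.mk f) hf

instance (W : MorphismProperty A) : (directedClosure κ W).RespectsIso :=
  MorphismProperty.RespectsIso.of_respects_arrow_iso _
    fun _ _ e h ↦ directedColimits_of_iso e h

section PullbackPresentation

variable [IsCardinalAccessibleCategory A κ] {J : Type w} [SmallCategory J]
  [IsCardinalFiltered J κ] {X Y Z : A} (pX : ColimitPresentation J X)
  (pY : ColimitPresentation J Y) (pZ : ColimitPresentation J Z)
  (φ : pX.diag ⟶ pZ.diag) (ψ : pY.diag ⟶ pZ.diag)
  (h : ∀ j, HasPullback (φ.app j) (ψ.app j)) {f : X ⟶ Z} {g : Y ⟶ Z}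
  (hf : ∀ j, φ.app j ≫ pZ.ι.app j = pX.ι.app j ≫ f)
  (hg : ∀ j, ψ.app j ≫ pZ.ι.app j = pY.ι.app j ≫ g)

include κ h hf hg

lemma hasPullback_of_colimitPresentation : HasPullback f g := by
  obtain ⟨P, α, β, sq⟩ := exists_functor_isPullback φ ψ h
  have := HasCardinalFilteredColimits.hasColimitsOfShape (κ := κ) A J
  let pP := ColimitPresentation.colimit P
  exact (isPullback_of_colimitPresentation (κ := κ) pP pX pY pZ α β φ ψ sq
    (a := pP.isColimit.desc (Cocone.mk X (α ≫ pX.ι)))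
    (b := pP.isColimit.desc (Cocone.mk Y (β ≫ pY.ι)))
    (fun j ↦ (pP.isColimit.fac (Cocone.mk X (α ≫ pX.ι)) j).symm)
    (fun j ↦ (pP.isColimit.fac (Cocone.mk Y (β ≫ pY.ι)) j).symm) hf hg).hasPullback

/-- The colimit of the stagewise pullbacks is a pullback of the same cospan, so its presentation
transports along the comparison isomorphism. -/
lemma exists_colimitPresentation_of_isPullback {P : A} {a : P ⟶ X} {b : P ⟶ Y}
    (s : IsPullback a b f g) :
    ∃ (pP : ColimitPresentation J P) (α : pP.diag ⟶ pX.diag) (β : pP.diag ⟶ pY.diag),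
      (∀ j, IsPullback (α.app j) (β.app j) (φ.app j) (ψ.app j)) ∧
      (∀ j, α.app j ≫ pX.ι.app j = pP.ι.app j ≫ a) ∧
      (∀ j, β.app j ≫ pY.ι.app j = pP.ι.app j ≫ b) := by
  obtain ⟨P, α, β, sq⟩ := exists_functor_isPullback φ ψ h
  have := HasCardinalFilteredColimits.hasColimitsOfShape (κ := κ) A J
  let pP := ColimitPresentation.colimit P
  let a' := pP.isColimit.desc (Cocone.mk X (α ≫ pX.ι))
  let b' := pP.isColimit.desc (Cocone.mk Y (β ≫ pY.ι))
  have ha (j : J) : α.app j ≫ pX.ι.app j = pP.ι.app j ≫ a' :=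
    (pP.isColimit.fac (Cocone.mk X (α ≫ pX.ι)) j).symm
  have hb (j : J) : β.app j ≫ pY.ι.app j = pP.ι.app j ≫ b' :=
    (pP.isColimit.fac (Cocone.mk Y (β ≫ pY.ι)) j).symm
  have s' : IsPullback a' b' f g :=
    isPullback_of_colimitPresentation (κ := κ) pP pX pY pZ α β φ ψ sq ha hb hf hg
  refine ⟨pP.ofIso (s'.isoIsPullback _ _ s), α, β, sq, fun j ↦ ?_, fun j ↦ ?_⟩
  · refine (ha j).trans (Eq.trans ?_ (Category.assoc _ _ _).symm)
    exact congrArg (pP.ι.app j ≫ ·) (s'.isoIsPullback_hom_fst _ _ s).symm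
  · refine (hb j).trans (Eq.trans ?_ (Category.assoc _ _ _).symm)
    exact congrArg (pP.ι.app j ≫ ·) (s'.isoIsPullback_hom_snd _ _ s).symm

end PullbackPresentation

/-- A morphism between `κ`-presentable objects which is a `κ`-directed colimit is a retract of
some stage. -/
lemma mem_of_directedClosure [HasCardinalFilteredColimits.{w} A κ] {W : MorphismProperty A}
    [W.IsStableUnderRetracts] {X Y : A} {f : X ⟶ Y} (hf : directedClosure κ W f)
    (hX : IsCardinalPresentable X κ) (hY : IsCardinalPresentable Y κ) : W f := by
  obtain ⟨J, _, _, pX, pY, φ, hφ, h⟩ := exists_colimitPresentation_of_directedColimits hf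
  have := isFiltered_of_isCardinalFiltered J κ
  obtain ⟨j₁, s, hs⟩ := IsCardinalPresentable.exists_hom_of_isColimit κ pX.isColimit (𝟙 X)
  obtain ⟨j₂, t, ht⟩ := IsCardinalPresentable.exists_hom_of_isColimit κ pY.isColimit (𝟙 Y)
  dsimp at hs ht h
  -- The lifts of the two identities form a morphism of arrows only once the two composites from `X`
  -- agree, which happens at stage `k`.
  obtain ⟨k, u, v, huv⟩ := IsCardinalPresentable.exists_eq_of_isColimit κ pY.isColimit
    (s ≫ φ.app j₁) (f ≫ t) (by
      dsimp
      rw [Category.assoc, Category.assoc, h, reassoc_of% hs, ht, Category.comp_id])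
  have hu := pX.w u
  have hv := pY.w v
  dsimp at hu hv
  refine MorphismProperty.of_retract (P := W) (g := φ.app k)
    { i := Arrow.homMk (s ≫ pX.diag.map u) (t ≫ pY.diag.map v) ?_
      r := Arrow.homMk (pX.ι.app k) (pY.ι.app k) (h k).symm
      retract := ?_ } (hφ k)
  · dsimp
    rw [Category.assoc, NatTrans.naturality]
    simpa using huv
  · ext
    · exact (Category.assoc _ _ _).trans ((congrArg (s ≫ ·) hu).trans hs)
    · exact (Category.assoc _ _ _).trans ((congrArg (t ≫ ·) hv).trans ht)

/-- A `κ`-directed colimit of morphisms from `W` and an arbitrary morphism with the same target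
can be presented compatibly. -/
lemma exists_compatible_presentation [IsCardinalAccessibleCategory A κ]
    {W : MorphismProperty A} {D E E' : A} {p : D ⟶ E} (hp : directedClosure κ W p)
    (f : E' ⟶ E) {K : Type w} [PartialOrder K] [IsCardinalFiltered K κ]
    (pE' : ColimitPresentation K E') (hE' : ∀ k, IsCardinalPresentable (pE'.diag.obj k) κ) :
    ∃ (T : Type w) (_ : PartialOrder T) (_ : IsCardinalFiltered T κ) (a : T ⥤ K) (_ : a.Final)
      (pD : ColimitPresentation T D) (pE : ColimitPresentation T E) (φ : pD.diag ⟶ pE.diag)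
      (ψ : (pE'.reindex a).diag ⟶ pE.diag), (∀ t, W (φ.app t)) ∧
      (∀ t, φ.app t ≫ pE.ι.app t = pD.ι.app t ≫ p) ∧
      (∀ t, ψ.app t ≫ pE.ι.app t = (pE'.reindex a).ι.app t ≫ f) := by
  obtain ⟨J, _, _, pD, pE, φ, hφ, h⟩ := exists_colimitPresentation_of_directedColimits hp
  obtain ⟨T, _, _, a, b, _, _, γ, hγ⟩ := exists_common_refinement pE' pE f hE'
  exact ⟨T, inferInstance, inferInstance, a, inferInstance, pD.reindex b, pE.reindex b,
    b.whiskerLeft φ, γ, fun t ↦ hφ _, fun t ↦ h _, hγ⟩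

/-! ### The closure is a QE-epi class. -/

namespace IsPresentableQEEpiClass

variable {W : MorphismProperty A} (hW : IsPresentableQEEpiClass κ W)

include hW

lemma of_isPullback {D' D E' E : A} {f' : D' ⟶ D} {p' : D' ⟶ E'} {p : D ⟶ E} {f : E' ⟶ E}
    (sq : IsPullback f' p' p f) (hp : W p) (hE' : IsCardinalPresentable E' κ) : W p' := by
  have := hW.isStableUnderRetracts
  obtain ⟨D'', f'', p'', sq', hp''⟩ := hW.exists_isPullback f hp hE'
  exact (W.arrow_mk_iso_iff (Arrow.isoMk (sq.isoIsPullback _ _ sq') (Iso.refl _)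
    (by simp))).2 hp''

lemma hasPullback {D E E' : A} {p : D ⟶ E} (f : E' ⟶ E) (hp : W p)
    (hE' : IsCardinalPresentable E' κ) : HasPullback p f := by
  obtain ⟨_, _, _, sq, _⟩ := hW.exists_isPullback f hp hE'
  exact sq.hasPullback

variable [IsCardinalAccessibleCategory A κ]

lemma hasPullback_of_directedClosure {D E E' : A} {p : D ⟶ E} (hp : directedClosure κ W p)
    (f : E' ⟶ E) : HasPullback p f := by
  obtain ⟨K, _, _, pE', hE'⟩ := exists_colimitPresentation_isCardinalPresentable (κ := κ) E'
  obtain ⟨T, _, _, a, _, pD, pE, φ, ψ, hφ, h₁, h₂⟩ :=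
    exists_compatible_presentation hp f pE' hE'
  exact hasPullback_of_colimitPresentation (κ := κ) pD (pE'.reindex a) pE φ ψ
    (fun t ↦ hW.hasPullback _ (hφ t) (hE' _)) h₁ h₂

/-- The pullback of a morphism in the closure can be presented over a refinement of any given
presentation of its target. -/
lemma exists_presentation_of_isPullback {D' D E E' : A} {f' : D' ⟶ D} {p' : D' ⟶ E'}
    {p : D ⟶ E} {f : E' ⟶ E} (sq : IsPullback f' p' p f) (hp : directedClosure κ W p)
    {K : Type w} [PartialOrder K] [IsCardinalFiltered K κ]
    (pE' : ColimitPresentation K E') (hE' : ∀ k, IsCardinalPresentable (pE'.diag.obj k) κ) :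
    ∃ (T : Type w) (_ : PartialOrder T) (_ : IsCardinalFiltered T κ) (a : T ⥤ K) (_ : a.Final)
      (pD' : ColimitPresentation T D') (β : pD'.diag ⟶ (pE'.reindex a).diag),
      (∀ t, W (β.app t)) ∧
      (∀ t, β.app t ≫ (pE'.reindex a).ι.app t = pD'.ι.app t ≫ p') := by
  obtain ⟨T, _, _, a, _, pD, pE, φ, ψ, hφ, h₁, h₂⟩ :=
    exists_compatible_presentation hp f pE' hE'
  obtain ⟨pD', α, β, sq', -, hβ⟩ := exists_colimitPresentation_of_isPullback (κ := κ) pD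
    (pE'.reindex a) pE φ ψ (fun t ↦ hW.hasPullback _ (hφ t) (hE' _)) h₁ h₂ sq
  exact ⟨T, inferInstance, inferInstance, a, inferInstance, pD', β,
    fun t ↦ hW.of_isPullback (sq' t) (hφ t) (hE' _), hβ⟩

lemma directedClosure_of_isPullback {D' D E E' : A} {f' : D' ⟶ D} {p' : D' ⟶ E'}
    {p : D ⟶ E} {f : E' ⟶ E} (sq : IsPullback f' p' p f) (hp : directedClosure κ W p) :
    directedClosure κ W p' := by
  obtain ⟨K, _, _, pE', hE'⟩ := exists_colimitPresentation_isCardinalPresentable (κ := κ) E'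
  obtain ⟨T, _, _, a, _, pD', β, hβ, h⟩ := hW.exists_presentation_of_isPullback sq hp pE' hE'
  exact directedColimits_arrow_mk pD' (pE'.reindex a) β hβ h

lemma directedClosure_id (X : A) : directedClosure κ W (𝟙 X) := by
  obtain ⟨K, _, _, pX, hX⟩ := exists_colimitPresentation_isCardinalPresentable (κ := κ) X
  exact directedColimits_arrow_mk pX pX (𝟙 _) (fun j ↦ hW.id_mem _ (hX j)) (fun j ↦ by simp)

lemma directedClosure_comp {X Y Z : A} {f : X ⟶ Y} {g : Y ⟶ Z} (hf : directedClosure κ W f)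
    (hg : directedClosure κ W g) : directedClosure κ W (f ≫ g) := by
  obtain ⟨J, _, _, pY, pZ, φ, hφ, h⟩ := exists_colimitPresentation_of_directedColimits hg
  -- Viewing `f` as its own pullback along the identity presents it over a refinement of the stages
  -- of `Y` already chosen for `g`, so the stages compose.
  obtain ⟨T, _, _, a, _, pX, β, hβ, h'⟩ := hW.exists_presentation_of_isPullback
    (IsPullback.id_horiz f) hf pY (fun j ↦ hW.isCardinalPresentable_src (hφ j))
  refine directedColimits_arrow_mk pX (pZ.reindex a) (β ≫ a.whiskerLeft φ)
    (fun t ↦ hW.comp_mem _ _ (hβ t) (hφ _)) (fun t ↦ ?_)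
  refine (Category.assoc _ _ _).trans ((congrArg (β.app t ≫ ·) (h (a.obj t))).trans ?_)
  exact (Category.assoc _ _ _).symm.trans ((congrArg (· ≫ g) (h' t)).trans (Category.assoc _ _ _))

/-- The kernel pair of a morphism in the closure is the colimit of the kernel pairs of the
stages. -/
lemma exists_kernelPair_presentation {K D E : A} {p : D ⟶ E} {k₁ k₂ : K ⟶ D}
    (hk : IsKernelPair p k₁ k₂) (hp : directedClosure κ W p) :
    ∃ (J : Type w) (_ : PartialOrder J) (_ : IsCardinalFiltered J κ)
      (pK : ColimitPresentation J K) (pD : ColimitPresentation J D)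
      (pE : ColimitPresentation J E) (α β : pK.diag ⟶ pD.diag) (φ : pD.diag ⟶ pE.diag),
      (∀ j, W (φ.app j)) ∧ (∀ j, IsKernelPair (φ.app j) (α.app j) (β.app j)) ∧
      (∀ j, α.app j ≫ pD.ι.app j = pK.ι.app j ≫ k₁) ∧
      (∀ j, β.app j ≫ pD.ι.app j = pK.ι.app j ≫ k₂) ∧
      (∀ j, φ.app j ≫ pE.ι.app j = pD.ι.app j ≫ p) := by
  obtain ⟨J, _, _, pD, pE, φ, hφ, h⟩ := exists_colimitPresentation_of_directedColimits hp
  obtain ⟨pK, α, β, sq, hα, hβ⟩ := exists_colimitPresentation_of_isPullback (κ := κ) pD pD pE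
    φ φ (fun j ↦ hW.hasPullback _ (hφ j) (hW.isCardinalPresentable_src (hφ j))) h h hk
  exact ⟨J, inferInstance, inferInstance, pK, pD, pE, α, β, φ, hφ, sq, hα, hβ, h⟩

lemma isCoequalizer_of_directedClosure {K D E : A} {p : D ⟶ E} {k₁ k₂ : K ⟶ D}
    (hk : IsKernelPair p k₁ k₂) (hp : directedClosure κ W p) :
    Nonempty (IsColimit (Cofork.ofπ p hk.w)) := by
  obtain ⟨J, _, _, pK, pD, pE, α, β, φ, hφ, sq, hα, hβ, h⟩ :=
    hW.exists_kernelPair_presentation hk hp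
  have hc (j : J) := (hW.isCoequalizer _ (hφ j) _ _ (sq j)).some
  have hepi (j : J) {Z : A} {u v : pE.diag.obj j ⟶ Z} (huv : φ.app j ≫ u = φ.app j ≫ v) :
      u = v := Cofork.IsColimit.hom_ext (hc j) huv
  have hdesc (j : J) {Z : A} (u : pD.diag.obj j ⟶ Z) (hu : α.app j ≫ u = β.app j ≫ u) :
      ∃ v : pE.diag.obj j ⟶ Z, φ.app j ≫ v = u :=
    ⟨_, (Cofork.IsColimit.desc' (hc j) u hu).2⟩
  dsimp at hα hβ h
  -- Restrict `u` to each stage and factor it through the stage coequalizer; the stage maps are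
  -- epimorphisms, so the factors form a cocone.
  have key {Z : A} (u : D ⟶ Z) (hu : k₁ ≫ u = k₂ ≫ u) : ∃ v : E ⟶ Z, p ≫ v = u := by
    choose v hv using fun j ↦ hdesc j (pD.ι.app j ≫ u)
      (by rw [reassoc_of% hα j, hu, ← reassoc_of% hβ j])
    let c : Cocone pE.diag := Cocone.mk Z
      { app := v
        naturality := fun i j t ↦ hepi i (by
          have := pD.w t
          dsimp at this ⊢
          rw [Category.comp_id, hv, ← NatTrans.naturality_assoc, hv, reassoc_of% this]) }
    refine ⟨pE.isColimit.desc c, pD.isColimit.hom_ext fun j ↦ ?_⟩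
    have : pE.ι.app j ≫ pE.isColimit.desc c = v j := pE.isColimit.fac c j
    dsimp
    rw [← reassoc_of% h j]
    exact (congrArg (φ.app j ≫ ·) this).trans (hv j)
  have hpepi {Z : A} {u v : E ⟶ Z} (huv : p ≫ u = p ≫ v) : u = v :=
    pE.isColimit.hom_ext fun j ↦ hepi j (by
      dsimp
      rw [reassoc_of% h j, reassoc_of% h j, huv])
  choose v hv using fun s : Cofork k₁ k₂ ↦ key s.π s.condition
  exact ⟨Cofork.IsColimit.mk _ v hv fun s m hm ↦ hpepi (hm.trans (hv s).symm)⟩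

lemma isQEEpiClass_directedClosure : IsQEEpiClass (directedClosure κ W) where
  hasPullback _ f hp := hW.hasPullback_of_directedClosure hp f
  isStableUnderBaseChange := ⟨fun sq hp ↦ hW.directedClosure_of_isPullback sq hp⟩
  isCoequalizer _ hp _ _ hk := hW.isCoequalizer_of_directedClosure hk hp
  isMultiplicative :=
    { id_mem := hW.directedClosure_id
      comp_mem := fun _ _ hf hg ↦ hW.directedClosure_comp hf hg }

end IsPresentableQEEpiClass

/-! ### `P`-sequences and strong local coherence. -/

section Sequences

variable [HasCardinalFilteredColimits.{w} A κ] {T : ObjectProperty (Shape ⥤ A)}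
  {F : Shape ⥤ A}

lemma map_evaluation_w {J : Type*} [Category* J] [HasColimitsOfShape J A]
    (p : ColimitPresentation J F) {X Y : Shape} (f : X ⟶ Y) (j : J) :
    (Functor.whiskerLeft p.diag ((evaluation Shape A).map f)).app j ≫
        (p.map ((evaluation Shape A).obj Y)).ι.app j =
      (p.map ((evaluation Shape A).obj X)).ι.app j ≫ F.map f := by
  simp only [ColimitPresentation.map_ι, Functor.constComp, NatTrans.comp_app,
    Functor.whiskerRight_app, Category.comp_id]
  exact ((p.ι.app j).naturality f)

lemma directedClosure_proj {W : MorphismProperty A} (hT : ∀ G, T G → W (G.map Shape.proj))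
    (h : directedColimits κ T F) : directedClosure κ W (F.map Shape.proj) := by
  obtain ⟨J, _, _, ⟨p⟩⟩ := h
  have := HasCardinalFilteredColimits.hasColimitsOfShape (κ := κ) A J
  exact directedColimits_arrow_mk
    (p.toColimitPresentation.map ((evaluation Shape A).obj .D))
    (p.toColimitPresentation.map ((evaluation Shape A).obj .E))
    (Functor.whiskerLeft p.diag ((evaluation Shape A).map Shape.proj))
    (fun j ↦ hT _ (p.prop_diag_obj j)) (map_evaluation_w _ _)

end Sequences

variable [IsCardinalAccessibleCategory A κ]

lemma isKernelPair_of_directedColimits {T : ObjectProperty (Shape ⥤ A)} {F : Shape ⥤ A}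
    (hT : ∀ G, T G → IsKernelPair (G.map Shape.proj) (G.map Shape.fst) (G.map Shape.snd))
    (h : directedColimits κ T F) :
    IsKernelPair (F.map Shape.proj) (F.map Shape.fst) (F.map Shape.snd) := by
  obtain ⟨J, _, _, ⟨p⟩⟩ := h
  have := HasCardinalFilteredColimits.hasColimitsOfShape (κ := κ) A J
  let pX (X : Shape) := p.toColimitPresentation.map ((evaluation Shape A).obj X)
  exact isPullback_of_colimitPresentation (κ := κ) (pX .K) (pX .D) (pX .D) (pX .E)
    (Functor.whiskerLeft p.diag ((evaluation Shape A).map Shape.fst))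
    (Functor.whiskerLeft p.diag ((evaluation Shape A).map Shape.snd))
    (Functor.whiskerLeft p.diag ((evaluation Shape A).map Shape.proj))
    (Functor.whiskerLeft p.diag ((evaluation Shape A).map Shape.proj))
    (fun j ↦ hT _ (p.prop_diag_obj j)) (map_evaluation_w _ _) (map_evaluation_w _ _)
    (map_evaluation_w _ _) (map_evaluation_w _ _)

lemma IsPresentableQEEpiClass.isStronglyLocallyCoherent {W : MorphismProperty A}
    (hW : IsPresentableQEEpiClass κ W) : IsStronglyLocallyCoherent κ (directedClosure κ W) := by
  have := hW.isStableUnderRetracts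
  refine ⟨⟨hW.isQEEpiClass_directedClosure, ?_⟩, fun sq hp hD hE hE' ↦
    hW.isCardinalPresentable_src (hW.of_isPullback sq (mem_of_directedClosure hp hD hE) hE')⟩
  ext F
  constructor
  · rintro ⟨hp, hk⟩
    obtain ⟨J, _, _, pK, pD, pE, α, β, φ, hφ, sq, hα, hβ, h⟩ :=
      hW.exists_kernelPair_presentation hk hp
    have w : α ≫ φ = β ≫ φ := by
      ext j
      exact (sq j).w
    refine ⟨J, inferInstance, inferInstance,
      ⟨{ toColimitPresentation := Shape.colimitPresentation pK pD pE α β φ w hα hβ h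
         prop_diag_obj := fun j ↦ ⟨⟨le_directedClosure _ _ (hφ j), sq j⟩, ?_⟩ }⟩⟩
    rintro (_ | _ | _)
    · exact hW.isCardinalPresentable_src
        (hW.of_isPullback (sq j) (hφ j) (hW.isCardinalPresentable_src (hφ j)))
    · exact hW.isCardinalPresentable_src (hφ j)
    · exact hW.isCardinalPresentable_tgt (hφ j)
  -- The stages have presentable terms, so their projections already lie in `W`; no iterated colimit
  -- has to be flattened.
  · exact fun h ↦ ⟨directedClosure_proj
      (fun G hG ↦ mem_of_directedClosure hG.1.1 (hG.2 _) (hG.2 _)) h,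
      isKernelPair_of_directedColimits (fun G hG ↦ hG.1.2) h⟩

/-- The morphisms of `P` between `κ`-presentable objects. -/
def presentablePart (κ : Cardinal.{w}) [Fact κ.IsRegular] (P : MorphismProperty A) :
    MorphismProperty A :=
  fun X Y f ↦ P f ∧ IsCardinalPresentable X κ ∧ IsCardinalPresentable Y κ

/-- A colimit of presentable morphisms of `P` extends to a colimit of their kernel pair sequences,
whose kernels are presentable by the strong condition; local coherence then applies. Conversely,
forget the kernels in a presentation of a `P`-sequence. -/
lemma IsStronglyLocallyCoherent.directedClosure_presentablePart {P : MorphismProperty A}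
    (hP : IsStronglyLocallyCoherent κ P) : directedClosure κ (presentablePart κ P) = P := by
  ext X Y f
  constructor
  · intro h
    obtain ⟨J, _, _, pX, pY, φ, hφ, h⟩ := exists_colimitPresentation_of_directedColimits h
    have hpb (j : J) : HasPullback (φ.app j) (φ.app j) := hP.isQEEpiClass.hasPullback _ _ (hφ j).1
    have := hasPullback_of_colimitPresentation (κ := κ) pX pX pY φ φ hpb h h
    have hk := IsPullback.of_hasPullback f f
    obtain ⟨pK, α, β, sq, hα, hβ⟩ :=
      exists_colimitPresentation_of_isPullback (κ := κ) pX pX pY φ φ hpb h h hk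
    have w : α ≫ φ = β ≫ φ := by
      ext j
      exact (sq j).w
    suffices sequences P (Shape.functor _ _ f hk.w) from this.1
    rw [hP.sequences_eq]
    refine ⟨J, inferInstance, inferInstance,
      ⟨{ toColimitPresentation := Shape.colimitPresentation (F := Shape.functor _ _ f hk.w)
          pK pX pY α β φ w hα hβ h
         prop_diag_obj := fun j ↦ ⟨⟨(hφ j).1, sq j⟩, ?_⟩ }⟩⟩
    rintro (_ | _ | _)
    · exact hP.isCardinalPresentable_pullback (sq j) (hφ j).1 (hφ j).2.1 (hφ j).2.2 (hφ j).2.1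
    · exact (hφ j).2.1
    · exact (hφ j).2.2
  · intro h
    have := hP.isQEEpiClass.hasPullback f f h
    have hk := IsPullback.of_hasPullback f f
    have hF : sequences P (Shape.functor _ _ f hk.w) := ⟨h, hk⟩
    rw [hP.sequences_eq] at hF
    exact directedClosure_proj (F := Shape.functor _ _ f hk.w)
      (fun G hG ↦ ⟨hG.1.1, hG.2 _, hG.2 _⟩) hF

end Closure

/-! ### Passing between the full subcategory of presentable objects and `A`. -/

section Transfer

variable {A : Type u} [Category.{w} A] {κ : Cardinal.{w}} [Fact κ.IsRegular]

/-- A class of morphisms in the category of `κ`-presentable objects, as a class of morphisms in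
the ambient category. -/
def ambient (Q : MorphismProperty (isCardinalPresentable A κ).FullSubcategory) :
    MorphismProperty A := fun X Y f ↦
  ∃ (hX : IsCardinalPresentable X κ) (hY : IsCardinalPresentable Y κ),
    Q (ObjectProperty.homMk (X := ⟨X, hX⟩) (Y := ⟨Y, hY⟩) f)

lemma colimitClosure_eq (Q : MorphismProperty (isCardinalPresentable A κ).FullSubcategory) :
    colimitClosure κ Q = directedClosure κ (ambient Q) := by
  have : (fun g : Arrow A ↦ ∃ (S T : (isCardinalPresentable A κ).FullSubcategory) (q : S ⟶ T),
      Q q ∧ g = Arrow.mk ((isCardinalPresentable A κ).ι.map q)) =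
      fun g : Arrow A ↦ ambient Q g.hom := by
    ext g
    constructor
    · rintro ⟨S, T, q, hq, rfl⟩
      exact ⟨S.2, T.2, hq⟩
    · rintro ⟨hX, hY, h⟩
      exact ⟨_, _, _, h, rfl⟩
  ext X Y f
  exact iff_of_eq (congrFun (congrArg (directedColimits κ) this) (Arrow.mk f))

lemma ambient_restrict (P : MorphismProperty A) : ambient (restrict κ P) = presentablePart κ P := by
  ext X Y f
  exact ⟨fun ⟨hX, hY, h⟩ ↦ ⟨h, hX, hY⟩, fun ⟨h, hX, hY⟩ ↦ ⟨hX, hY, h⟩⟩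

variable [IsCardinalAccessibleCategory A κ]

/-- Presentable test objects detect pullbacks in `A`, and the subcategory contains all of them. -/
lemma isPullback_hom {P X Y Z : (isCardinalPresentable A κ).FullSubcategory} {a : P ⟶ X}
    {b : P ⟶ Y} {f : X ⟶ Z} {g : Y ⟶ Z} (sq : IsPullback a b f g) :
    IsPullback a.hom b.hom f.hom g.hom := by
  refine isPullback_of_isCardinalPresentable (κ := κ)
    (congrArg InducedCategory.Hom.hom sq.w) (fun S hS u v huv ↦ ?_)
  let S' : (isCardinalPresentable A κ).FullSubcategory := ⟨S, hS⟩
  have h : ObjectProperty.homMk (X := S') u ≫ f = ObjectProperty.homMk (X := S') v ≫ g :=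
    ObjectProperty.hom_ext _ huv
  refine ⟨(sq.lift _ _ h).hom, ⟨?_, ?_⟩, fun m hm ↦ ?_⟩
  · exact congrArg InducedCategory.Hom.hom (sq.lift_fst _ _ h)
  · exact congrArg InducedCategory.Hom.hom (sq.lift_snd _ _ h)
  · refine congrArg InducedCategory.Hom.hom
      (sq.hom_ext (k := ObjectProperty.homMk (X := S') m) ?_ ?_)
    · rw [sq.lift_fst]
      exact ObjectProperty.hom_ext _ hm.1
    · rw [sq.lift_snd]
      exact ObjectProperty.hom_ext _ hm.2

omit [IsCardinalAccessibleCategory A κ] in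
lemma isPullback_of_hom {P X Y Z : (isCardinalPresentable A κ).FullSubcategory} {a : P ⟶ X}
    {b : P ⟶ Y} {f : X ⟶ Z} {g : Y ⟶ Z} (sq : IsPullback a.hom b.hom f.hom g.hom) :
    IsPullback a b f g :=
  IsPullback.of_map (isCardinalPresentable A κ).ι (ObjectProperty.hom_ext _ sq.w) sq

omit [IsCardinalAccessibleCategory A κ] in
lemma nonempty_isColimit_of_hom {K D E : (isCardinalPresentable A κ).FullSubcategory}
    {k₁ k₂ : K ⟶ D} {p : D ⟶ E} (w : k₁ ≫ p = k₂ ≫ p)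
    (w' : k₁.hom ≫ p.hom = k₂.hom ≫ p.hom)
    (h : Nonempty (IsColimit (Cofork.ofπ p.hom w'))) :
    Nonempty (IsColimit (Cofork.ofπ p w)) :=
  ⟨isColimitOfIsColimitCoforkMap (isCardinalPresentable A κ).ι w h.some⟩

/-- Coequalizers in the full subcategory of `κ`-presentable objects are coequalizers in the
ambient category. -/
lemma nonempty_isColimit_hom {K D E : (isCardinalPresentable A κ).FullSubcategory}
    {k₁ k₂ : K ⟶ D} {p : D ⟶ E} (w : k₁ ≫ p = k₂ ≫ p)
    (w' : k₁.hom ≫ p.hom = k₂.hom ≫ p.hom)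
    (h : Nonempty (IsColimit (Cofork.ofπ p w))) :
    Nonempty (IsColimit (Cofork.ofπ p.hom w')) := by
  obtain ⟨h⟩ := h
  have hepi {Z : A} (hZ : IsCardinalPresentable Z κ) {u v : E.obj ⟶ Z}
      (huv : p.hom ≫ u = p.hom ≫ v) : u = v := by
    let Z' : (isCardinalPresentable A κ).FullSubcategory := ⟨Z, hZ⟩
    let u' : E ⟶ Z' := ObjectProperty.homMk u
    let v' : E ⟶ Z' := ObjectProperty.homMk v
    have huv' : p ≫ u' = p ≫ v' := ObjectProperty.hom_ext _ huv
    exact congrArg InducedCategory.Hom.hom (Cofork.IsColimit.hom_ext h huv')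
  have hdesc {Z : A} (hZ : IsCardinalPresentable Z κ) (u : D.obj ⟶ Z)
      (hu : k₁.hom ≫ u = k₂.hom ≫ u) : ∃ v, p.hom ≫ v = u := by
    let Z' : (isCardinalPresentable A κ).FullSubcategory := ⟨Z, hZ⟩
    obtain ⟨v, hv⟩ := Cofork.IsColimit.desc' h (ObjectProperty.homMk (Y := Z') u)
      (ObjectProperty.hom_ext _ hu)
    exact ⟨v.hom, congrArg InducedCategory.Hom.hom hv⟩
  -- A general target is a colimit of presentable ones. Since `K`, `D` and `E` are presentable, the
  -- maps and equations involved descend to a stage, where the property in the subcategory applies.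
  have hepi' {Z : A} {u v : E.obj ⟶ Z} (huv : p.hom ≫ u = p.hom ≫ v) : u = v := by
    obtain ⟨J, _, _, pZ, hZ⟩ := exists_colimitPresentation_isCardinalPresentable (κ := κ) Z
    have := isFiltered_of_isCardinalFiltered J κ
    obtain ⟨j₁, u', rfl⟩ := IsCardinalPresentable.exists_hom_of_isColimit κ pZ.isColimit u
    obtain ⟨j₂, v', rfl⟩ := IsCardinalPresentable.exists_hom_of_isColimit κ pZ.isColimit v
    obtain ⟨j, s, t, hst⟩ := IsCardinalPresentable.exists_eq_of_isColimit κ pZ.isColimit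
      (p.hom ≫ u') (p.hom ≫ v') (by simpa only [Category.assoc] using huv)
    have hs := pZ.w s
    have ht := pZ.w t
    dsimp at hs ht ⊢
    simp only [Category.assoc] at hst
    rw [← hs, ← ht, reassoc_of% hepi (hZ j) hst]
  have hdesc' {Z : A} (u : D.obj ⟶ Z) (hu : k₁.hom ≫ u = k₂.hom ≫ u) :
      ∃ v, p.hom ≫ v = u := by
    obtain ⟨J, _, _, pZ, hZ⟩ := exists_colimitPresentation_isCardinalPresentable (κ := κ) Z
    obtain ⟨i, u', rfl⟩ := IsCardinalPresentable.exists_hom_of_isColimit κ pZ.isColimit u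
    obtain ⟨j, t, ht⟩ := IsCardinalPresentable.exists_eq_of_isColimit' κ pZ.isColimit
      (k₁.hom ≫ u') (k₂.hom ≫ u') (by simpa only [Category.assoc] using hu)
    obtain ⟨v, hv⟩ := hdesc (hZ j) (u' ≫ pZ.diag.map t) (by simpa only [Category.assoc] using ht)
    refine ⟨v ≫ pZ.ι.app j, ?_⟩
    have := pZ.w t
    dsimp at this ⊢
    rw [reassoc_of% hv, this]
  choose v hv using fun s : Cofork k₁.hom k₂.hom ↦ hdesc' s.π s.condition
  exact ⟨Cofork.IsColimit.mk _ v hv fun s m hm ↦ hepi' (hm.trans (hv s).symm)⟩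

lemma isPresentableQEEpiClass_ambient
    {Q : MorphismProperty (isCardinalPresentable A κ).FullSubcategory}
    (hQ : IsQEEpiClass Q) (hQ' : Q.IsStableUnderRetracts) :
    IsPresentableQEEpiClass κ (ambient Q) where
  isCardinalPresentable_src h := h.1
  isCardinalPresentable_tgt h := h.2.1
  exists_isPullback := by
    rintro D E E' p f ⟨hD, hE, hp⟩ hE'
    let f' : (⟨E', hE'⟩ : (isCardinalPresentable A κ).FullSubcategory) ⟶ ⟨E, hE⟩ :=
      ObjectProperty.homMk f
    have := hQ.hasPullback _ f' hp
    let p' : (⟨D, hD⟩ : (isCardinalPresentable A κ).FullSubcategory) ⟶ ⟨E, hE⟩ :=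
      ObjectProperty.homMk p
    have sq := IsPullback.of_hasPullback p' f'
    exact ⟨_, _, _, isPullback_hom sq, (pullback p' f').2, hE',
      hQ.isStableUnderBaseChange.of_isPullback sq hp⟩
  isCoequalizer := by
    rintro K D E p ⟨hD, hE, hp⟩ k₁ k₂ hk
    let p' : (⟨D, hD⟩ : (isCardinalPresentable A κ).FullSubcategory) ⟶ ⟨E, hE⟩ :=
      ObjectProperty.homMk p
    have := hQ.hasPullback _ p' hp
    have sq := isPullback_hom (IsPullback.of_hasPullback p' p')
    -- The kernel pair formed in the subcategory is also one in `A`, so `K` is isomorphic to a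
    -- presentable object.
    have hK : IsCardinalPresentable K κ :=
      (isCardinalPresentable A κ).prop_of_iso (sq.isoIsPullback _ _ hk) (pullback p' p').2
    let k₁' : (⟨K, hK⟩ : (isCardinalPresentable A κ).FullSubcategory) ⟶ ⟨D, hD⟩ :=
      ObjectProperty.homMk k₁
    let k₂' : (⟨K, hK⟩ : (isCardinalPresentable A κ).FullSubcategory) ⟶ ⟨D, hD⟩ :=
      ObjectProperty.homMk k₂
    have hk' : IsKernelPair p' k₁' k₂' := isPullback_of_hom hk
    exact nonempty_isColimit_hom hk'.w hk.w (hQ.isCoequalizer p' hp _ _ hk')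
  id_mem X hX := ⟨hX, hX, hQ.isMultiplicative.id_mem ⟨X, hX⟩⟩
  comp_mem f g := by
    rintro ⟨hX, hY, hf⟩ ⟨_, hZ, hg⟩
    exact ⟨hX, hZ, hQ.isMultiplicative.comp_mem _ _ hf hg⟩
  isStableUnderRetracts := ⟨by
    rintro X Y Z W f g h ⟨hZ, hW, hg⟩
    have hX : isCardinalPresentable A κ X :=
      (isCardinalPresentable A κ).prop_of_retract h.left hZ
    have hY : isCardinalPresentable A κ Y :=
      (isCardinalPresentable A κ).prop_of_retract h.right hW
    refine ⟨hX, hY, hQ'.of_retract ?_ hg⟩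
    exact
      { i := Arrow.homMk (ObjectProperty.homMk h.i.left) (ObjectProperty.homMk h.i.right)
          (ObjectProperty.hom_ext _ h.i.w)
        r := Arrow.homMk (ObjectProperty.homMk h.r.left) (ObjectProperty.homMk h.r.right)
          (ObjectProperty.hom_ext _ h.r.w)
        retract := by
          ext
          · exact congrArg CommaMorphism.left h.retract
          · exact congrArg CommaMorphism.right h.retract }⟩

lemma IsStronglyLocallyCoherent.isQEEpiClass_restrict {P : MorphismProperty A}
    (hP : IsStronglyLocallyCoherent κ P) : IsQEEpiClass (restrict κ P) where
  hasPullback {D E E'} p f hp := by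
    have := hP.isQEEpiClass.hasPullback p.hom f.hom hp
    have sq := IsPullback.of_hasPullback p.hom f.hom
    let D' : (isCardinalPresentable A κ).FullSubcategory :=
      ⟨pullback p.hom f.hom, hP.isCardinalPresentable_pullback sq hp D.2 E.2 E'.2⟩
    exact (isPullback_of_hom (P := D') (a := ObjectProperty.homMk (pullback.fst p.hom f.hom))
      (b := ObjectProperty.homMk (pullback.snd p.hom f.hom)) sq).hasPullback
  isStableUnderBaseChange :=
    ⟨fun sq hp ↦ hP.isQEEpiClass.isStableUnderBaseChange.of_isPullback (isPullback_hom sq) hp⟩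
  isCoequalizer p hp k₁ k₂ hk :=
    nonempty_isColimit_of_hom hk.w _
      (hP.isQEEpiClass.isCoequalizer p.hom hp _ _ (isPullback_hom hk))
  isMultiplicative :=
    have := hP.isQEEpiClass.isMultiplicative
    inferInstanceAs (P.inverseImage (isCardinalPresentable A κ).ι).IsMultiplicative

lemma IsStronglyLocallyCoherent.colimitClosure_restrict {P : MorphismProperty A}
    (hP : IsStronglyLocallyCoherent κ P) : colimitClosure κ (restrict κ P) = P := by
  rw [colimitClosure_eq, ambient_restrict, hP.directedClosure_presentablePart]

lemma IsStronglyLocallyCoherent.isStableUnderRetracts_restrict {P : MorphismProperty A}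
    (hP : IsStronglyLocallyCoherent κ P) : (restrict κ P).IsStableUnderRetracts := by
  refine ⟨fun {X Y Z W f g} h hg ↦ ?_⟩
  have h' : directedClosure κ (presentablePart κ P) f.hom :=
    directedColimits_of_retract (T := fun g : Arrow A ↦ presentablePart κ P g.hom)
      (h.map (isCardinalPresentable A κ).ι) ⟨hg, Z.2, W.2⟩
  rwa [hP.directedClosure_presentablePart] at h'

lemma restrict_colimitClosure
    {Q : MorphismProperty (isCardinalPresentable A κ).FullSubcategory}
    (hQ' : (ambient Q).IsStableUnderRetracts) : restrict κ (colimitClosure κ Q) = Q := by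
  ext X Y f
  rw [colimitClosure_eq]
  exact ⟨fun h ↦ (mem_of_directedClosure h X.2 Y.2).2.2,
    fun h ↦ le_directedClosure _ _ ⟨X.2, Y.2, h⟩⟩

end Transfer

end QEEpi

theorem corollary9p2 {A : Type u} [Category.{w} A] (κ : Cardinal.{w}) [Fact κ.IsRegular]
    [IsCardinalAccessibleCategory A κ] :
    ∃ e : {P : MorphismProperty A // QEEpi.IsStronglyLocallyCoherent κ P} ≃
        {Q : MorphismProperty (isCardinalPresentable A κ).FullSubcategory //
          QEEpi.IsQEEpiClass Q ∧ Q.IsStableUnderRetracts},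
      (∀ P, (e P : MorphismProperty (isCardinalPresentable A κ).FullSubcategory) =
        QEEpi.restrict κ (P : MorphismProperty A)) ∧
      (∀ Q, (e.symm Q : MorphismProperty A) = QEEpi.colimitClosure κ
        (Q : MorphismProperty (isCardinalPresentable A κ).FullSubcategory)) :=
  ⟨{ toFun := fun P ↦ ⟨QEEpi.restrict κ P.1,
        P.2.isQEEpiClass_restrict, P.2.isStableUnderRetracts_restrict⟩
     invFun := fun Q ↦ ⟨QEEpi.colimitClosure κ Q.1, by
        rw [QEEpi.colimitClosure_eq]
        exact (QEEpi.isPresentableQEEpiClass_ambient Q.2.1 Q.2.2).isStronglyLocallyCoherent⟩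
     left_inv := fun P ↦ Subtype.ext P.2.colimitClosure_restrict
     right_inv := fun Q ↦ Subtype.ext (QEEpi.restrict_colimitClosure
        (QEEpi.isPresentableQEEpiClass_ambient Q.2.1 Q.2.2).isStableUnderRetracts) },
    fun _ ↦ rfl, fun _ ↦ rfl⟩
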